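/- Let $N\ge 0$ be an integer, let $\mathcal U_N$ be the group of unitary operators on $\mathcal H=(\mathbb C^2)^{\otimes N}$, let $\mathcal P_N=\{\pm1,\pm i\}\cdot\{\mathrm I,\mathrm X,\mathrm Y,\mathrm Z\}^{\otimes N}$ be the $N$-qubit Pauli group, and let $\mathcal C_N=\{U\in\mathcal U_N : U\mathcal P_N U^\dagger=\mathcal P_N\}$ be the Clifford group, i.e. the normalizer of $\mathcal P_N$ in $\mathcal U_N$. For a subgroup $\mathcal G$ of $\mathcal U_N$ put $$\mathcal U_{N,\mathcal G}=\{U\in\mathcal U_N : UG=GU\text{ for all }G\in\mathcal G\},\qquad \mathcal C_{N,\mathcal G}=\mathcal C_N\cap\mathcal U_{N,\mathcal G}.$$ For a compact subgroup $\mathcal X$ of $\mathcal U_N$ with normalized Haar measure $\mu_{\mathcal X}$, and $t\ge 0$, the $t$-fold twirling channel is $$\Phi_{t,\mathcal X}(L)=\int_{\mathcal X}U^{\otimes t}\,L\,(U^{\otimes t})^{\dagger}\,d\mu_{\mathcal X}(U)$$ for all linear operators $L$ on $\mathcal H^{\otimes t}$. The group $\mathcal X$ is called a $\mathcal G$-symmetric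 unitary $t$-design if $\Phi_{t,\mathcal X}=\Phi_{t,\mathcal U_{N,\mathcal G}}$. **Theorem.** Let $\mathcal G$ be any subgroup of $\mathcal U_N$. Then the (compact) group $\mathcal C_{N,\mathcal G}$ is a $\mathcal G$-symmetric unitary $3$-design if and only if $\mathcal U_{N,\mathcal G}=\mathcal U_{N,\mathcal Q}$ for some subgroup $\mathcal Q$ of $\mathcal P_N$. -/

import Mathlib

open MeasureTheory TopologicalSpace

/-- The tensor product `⨂ⱼ A j` of a family of square matrices, acting on the tensor product of the
factors; its basis is indexed by the tuples of basis indices of the factors. -/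
def tensorFamily {ι n : Type*} [Fintype ι] (A : ι → Matrix n n ℂ) :
    Matrix (ι → n) (ι → n) ℂ :=
  Matrix.of fun x y => ∏ j, A j (x j) (y j)

theorem tensorFamily_mul {ι n : Type*} [Fintype ι] [DecidableEq ι] [Fintype n]
    (A B : ι → Matrix n n ℂ) :
    tensorFamily A * tensorFamily B = tensorFamily fun j => A j * B j := by
  ext x y
  simp only [tensorFamily, Matrix.mul_apply, Matrix.of_apply, Finset.prod_univ_sum,
    Fintype.piFinset_univ, Finset.prod_mul_distrib]

theorem tensorFamily_one {ι n : Type*} [Fintype ι] [DecidableEq n] :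
    (tensorFamily fun _ : ι => (1 : Matrix n n ℂ)) = 1 := by
  classical
  ext x y
  by_cases h : x = y
  · subst h
    simp [tensorFamily]
  · obtain ⟨j, hj⟩ := Function.ne_iff.mp h
    rw [Matrix.one_apply_ne h]
    exact Finset.prod_eq_zero (Finset.mem_univ j) (Matrix.one_apply_ne hj)

theorem tensorFamily_conjTranspose {ι n : Type*} [Fintype ι] (A : ι → Matrix n n ℂ) :
    (tensorFamily A).conjTranspose = tensorFamily fun j => (A j).conjTranspose := by
  ext x y
  simp [tensorFamily, Matrix.conjTranspose_apply]

theorem tensorFamily_smul {ι n : Type*} [Fintype ι] (c : ι → ℂ) (A : ι → Matrix n n ℂ) :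
    (tensorFamily fun j => c j • A j) = (∏ j, c j) • tensorFamily A := by
  ext x y
  simp [tensorFamily, Finset.prod_mul_distrib]

/-- The tensor power `A^{⊗t}`. -/
def tensorPower {n : Type*} (t : ℕ) (A : Matrix n n ℂ) : Matrix (Fin t → n) (Fin t → n) ℂ :=
  tensorFamily fun _ : Fin t => A

/-- Computational basis of `N` qubits. -/
abbrev Qubits (N : ℕ) : Type := Fin N → Fin 2

/-- The unitary group on `N` qubits. -/
abbrev QubitUnitary (N : ℕ) : Type := Matrix.unitaryGroup (Qubits N) ℂ

/-- The single-qubit Pauli matrices `I, X, Y, Z`. -/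
def pauliMatrix : Fin 4 → Matrix (Fin 2) (Fin 2) ℂ :=
  ![!![1, 0; 0, 1], !![0, 1; 1, 0], !![0, -Complex.I; Complex.I, 0], !![1, 0; 0, -1]]

/-- The Pauli string `P₁ ⊗ ⋯ ⊗ P_N` with `Pⱼ ∈ {I, X, Y, Z}`. -/
def pauliString {N : ℕ} (s : Fin N → Fin 4) : Matrix (Qubits N) (Qubits N) ℂ :=
  tensorFamily fun j => pauliMatrix (s j)

theorem pauliMatrix_sq (a : Fin 4) : pauliMatrix a * pauliMatrix a = 1 := by
  fin_cases a <;> simp [pauliMatrix, Matrix.one_fin_two]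

theorem pauliMatrix_conjTranspose (a : Fin 4) :
    (pauliMatrix a).conjTranspose = pauliMatrix a := by
  fin_cases a <;> ext i j <;> fin_cases i <;> fin_cases j <;> simp [pauliMatrix]

theorem pauliMatrix_mul (a b : Fin 4) : ∃ (c : ℂ) (d : Fin 4),
    c ^ 4 = 1 ∧ pauliMatrix a * pauliMatrix b = c • pauliMatrix d := by
  have hI : Complex.I ^ 4 = 1 := Complex.I_pow_four
  have hI' : (-Complex.I) ^ 4 = 1 := by rw [Even.neg_pow (by decide), hI]
  fin_cases a <;> fin_cases b
  · exact ⟨1, 0, by simp, by simp [pauliMatrix]⟩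
  · exact ⟨1, 1, by simp, by simp [pauliMatrix]⟩
  · exact ⟨1, 2, by simp, by simp [pauliMatrix]⟩
  · exact ⟨1, 3, by simp, by simp [pauliMatrix]⟩
  · exact ⟨1, 1, by simp, by simp [pauliMatrix]⟩
  · exact ⟨1, 0, by simp, by simp [pauliMatrix]⟩
  · exact ⟨Complex.I, 3, hI, by simp [pauliMatrix]⟩
  · exact ⟨-Complex.I, 2, hI', by simp [pauliMatrix]⟩
  · exact ⟨1, 2, by simp, by simp [pauliMatrix]⟩
  · exact ⟨-Complex.I, 3, hI', by simp [pauliMatrix]⟩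
  · exact ⟨1, 0, by simp, by simp [pauliMatrix]⟩
  · exact ⟨Complex.I, 1, hI, by simp [pauliMatrix]⟩
  · exact ⟨1, 3, by simp, by simp [pauliMatrix]⟩
  · exact ⟨Complex.I, 2, hI, by simp [pauliMatrix]⟩
  · exact ⟨-Complex.I, 1, hI', by simp [pauliMatrix]⟩
  · exact ⟨1, 0, by simp, by simp [pauliMatrix]⟩

theorem pauliString_conjTranspose {N : ℕ} (s : Fin N → Fin 4) :
    (pauliString s).conjTranspose = pauliString s := by
  simp only [pauliString, tensorFamily_conjTranspose, pauliMatrix_conjTranspose]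

theorem pauliString_mul {N : ℕ} (s s' : Fin N → Fin 4) : ∃ (c : ℂ) (r : Fin N → Fin 4),
    c ^ 4 = 1 ∧ pauliString s * pauliString s' = c • pauliString r := by
  choose c d hc hd using pauliMatrix_mul
  refine ⟨∏ j, c (s j) (s' j), fun j => d (s j) (s' j), ?_, ?_⟩
  · simp [← Finset.prod_pow, hc]
  · simp only [pauliString, tensorFamily_mul, hd, tensorFamily_smul]

/-- The Pauli group `{±1, ±i} · {I, X, Y, Z}^{⊗N}`; the phases `±1, ±i` are the complex numbers `c`
with `c ^ 4 = 1`. -/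
def pauliGroup (N : ℕ) : Subgroup (QubitUnitary N) where
  carrier := {U | ∃ (c : ℂ) (s : Fin N → Fin 4), c ^ 4 = 1 ∧
    (U : Matrix (Qubits N) (Qubits N) ℂ) = c • pauliString s}
  one_mem' := by
    refine ⟨1, fun _ => 0, by simp, ?_⟩
    have h : pauliMatrix 0 = 1 := by simp [pauliMatrix, Matrix.one_fin_two]
    simp only [pauliString, h, tensorFamily_one, one_smul]
    rfl
  mul_mem' := by
    rintro U V ⟨c, s, hc, hU⟩ ⟨d, s', hd, hV⟩
    obtain ⟨e, r, he, hr⟩ := pauliString_mul s s'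
    refine ⟨c * d * e, r, by rw [mul_pow, mul_pow, hc, hd, he]; norm_num, ?_⟩
    change (U : Matrix (Qubits N) (Qubits N) ℂ) * (V : Matrix (Qubits N) (Qubits N) ℂ) = _
    rw [hU, hV, Matrix.smul_mul, Matrix.mul_smul, hr, smul_smul, smul_smul]
  inv_mem' := by
    rintro U ⟨c, s, hc, hU⟩
    refine ⟨star c, s, by rw [← star_pow, hc, star_one], ?_⟩
    change star (U : Matrix (Qubits N) (Qubits N) ℂ) = _
    rw [hU, Matrix.star_eq_conjTranspose, Matrix.conjTranspose_smul, pauliString_conjTranspose]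

/-- The Clifford group: the normalizer of the Pauli group in the unitary group. -/
def cliffordGroup (N : ℕ) : Subgroup (QubitUnitary N) :=
  Subgroup.normalizer (pauliGroup N : Set (QubitUnitary N))

/-- The `G`-symmetric unitary group: all unitaries that commute with every element of `G`. -/
def symmetricUnitary {N : ℕ} (G : Subgroup (QubitUnitary N)) : Subgroup (QubitUnitary N) :=
  Subgroup.centralizer (G : Set (QubitUnitary N))

/-- The `G`-symmetric Clifford group. -/
def symmetricClifford {N : ℕ} (G : Subgroup (QubitUnitary N)) : Subgroup (QubitUnitary N) :=
  cliffordGroup N ⊓ symmetricUnitary G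

noncomputable instance (N : ℕ) : MeasurableSpace (QubitUnitary N) := borel _

instance (N : ℕ) : BorelSpace (QubitUnitary N) := ⟨rfl⟩

/-- The Haar measure of total mass one on a compact group of unitaries. -/
noncomputable def normalizedHaar {N : ℕ} (X : Subgroup (QubitUnitary N)) [CompactSpace X] :
    Measure X :=
  Measure.haarMeasure (⊤ : PositiveCompacts X)

/-- The `t`-fold twirling channel `L ↦ ∫_X U^{⊗t} L (U^{⊗t})† dU`. The integral of a
matrix-valued function is taken entry by entry. -/
noncomputable def twirl {N : ℕ} (t : ℕ) (X : Subgroup (QubitUnitary N)) [CompactSpace X]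
    (L : Matrix (Fin t → Qubits N) (Fin t → Qubits N) ℂ) :
    Matrix (Fin t → Qubits N) (Fin t → Qubits N) ℂ :=
  Matrix.of fun x y => ∫ U : X,
    (tensorPower t ((U : QubitUnitary N) : Matrix (Qubits N) (Qubits N) ℂ) * L *
      (tensorPower t ((U : QubitUnitary N) : Matrix (Qubits N) (Qubits N) ℂ)).conjTranspose) x y
    ∂normalizedHaar X

instance (N : ℕ) : CompactSpace (QubitUnitary N) := by
  refine isCompact_iff_compactSpace.mp ?_
  have hc : IsCompact {A : Matrix (Qubits N) (Qubits N) ℂ |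
      A ∈ Set.univ.pi fun _ : Qubits N => Set.univ.pi fun _ : Qubits N =>
        Metric.closedBall (0 : ℂ) 1} :=
    isCompact_univ_pi fun _ => isCompact_univ_pi fun _ => isCompact_closedBall _ _
  refine hc.of_isClosed_subset
    (isClosed_unitary (R := Matrix (Qubits N) (Qubits N) ℂ)) ?_
  intro U hU i _ j _
  simpa using entry_norm_bound_of_unitary hU i j

theorem finite_pauliGroup (N : ℕ) : (pauliGroup N : Set (QubitUnitary N)).Finite := by
  have h4 : {c : ℂ | c ^ 4 = 1}.Finite := by
    refine (Polynomial.nthRootsFinset 4 (1 : ℂ)).finite_toSet.subset fun c hc => ?_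
    simpa [Polynomial.mem_nthRootsFinset (by norm_num : 0 < 4)] using hc
  refine Set.Finite.of_finite_image (f := Subtype.val) ?_ Subtype.val_injective.injOn
  refine ((h4.prod (Set.finite_univ (α := Fin N → Fin 4))).image
    fun p => p.1 • pauliString p.2).subset ?_
  rintro _ ⟨U, ⟨c, s, hc, hU⟩, rfl⟩
  exact ⟨(c, s), ⟨hc, Set.mem_univ _⟩, hU.symm⟩

theorem isClosed_symmetricUnitary {N : ℕ} (G : Subgroup (QubitUnitary N)) :
    IsClosed (symmetricUnitary G : Set (QubitUnitary N)) :=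
  Set.isClosed_centralizer _

theorem isClosed_normalizer_of_isClosed {M : Type*} [Group M] [TopologicalSpace M]
    [IsTopologicalGroup M] (P : Subgroup M) (hP : IsClosed (P : Set M)) :
    IsClosed (Subgroup.normalizer (P : Set M) : Set M) := by
  have h : (Subgroup.normalizer (P : Set M) : Set M) =
      ⋂ p ∈ P, {U | U * p * U⁻¹ ∈ (P : Set M)} ∩ {U | U⁻¹ * p * U ∈ (P : Set M)} := by
    ext U
    simp only [SetLike.mem_coe, Subgroup.mem_normalizer_iff, Set.mem_iInter,
      Set.mem_inter_iff, Set.mem_ofPred_eq]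
    constructor
    · intro h p hp
      refine ⟨(h p).mp hp, (h _).mpr ?_⟩
      simpa [mul_assoc] using hp
    · intro h p
      refine ⟨fun hp => (h p hp).1, fun hp => ?_⟩
      simpa [mul_assoc] using (h _ hp).2
  rw [h]
  refine isClosed_biInter fun p _ => IsClosed.inter ?_ ?_
  · exact hP.preimage (by fun_prop : Continuous fun U : M => U * p * U⁻¹)
  · exact hP.preimage (by fun_prop : Continuous fun U : M => U⁻¹ * p * U)

theorem isClosed_cliffordGroup (N : ℕ) : IsClosed (cliffordGroup N : Set (QubitUnitary N)) :=
  isClosed_normalizer_of_isClosed (pauliGroup N) (finite_pauliGroup N).isClosed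

instance {N : ℕ} (G : Subgroup (QubitUnitary N)) : CompactSpace (symmetricUnitary G) :=
  isCompact_iff_compactSpace.mp (isClosed_symmetricUnitary G).isCompact

theorem isClosed_symmetricClifford {N : ℕ} (G : Subgroup (QubitUnitary N)) :
    IsClosed (symmetricClifford G : Set (QubitUnitary N)) := by
  rw [symmetricClifford, Subgroup.coe_inf]
  exact (isClosed_cliffordGroup N).inter (isClosed_symmetricUnitary G)

instance {N : ℕ} (G : Subgroup (QubitUnitary N)) : CompactSpace (symmetricClifford G) :=
  isCompact_iff_compactSpace.mp (isClosed_symmetricClifford G).isCompact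

/-- A compact group `X` of unitaries is a `G`-symmetric unitary `t`-design if its `t`-fold twirling
channel agrees with that of the whole `G`-symmetric unitary group. -/
def IsSymmetricDesign {N : ℕ} (t : ℕ) (G X : Subgroup (QubitUnitary N)) [CompactSpace X] : Prop :=
  twirl t X = twirl t (symmetricUnitary G)

/-!
Write `A` for the algebra commuting with `G`, so that `symmetricUnitary G` is its unitary group.
By invariance of the Haar measure, the twirl over a group is a projection onto the commutant of its
tensor powers, so for nested groups equality of twirls is equality of these commutants
(`twirl_eq_of_le`, `tensorConj_twirl`). The question is therefore when an operator `L` on three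
copies that commutes with `C ⊗ C ⊗ C` for all symmetric Cliffords `C` also commutes with
`U ⊗ U ⊗ U` for all symmetric unitaries `U`. For an operator `M` put
`slotSum M = M ⊗ 1 ⊗ 1 + 1 ⊗ M ⊗ 1 + 1 ⊗ 1 ⊗ M`.

Suppose the symmetry is given by a group `Q` of Pauli operators. Then `A` is spanned by the Pauli
strings `P` commuting with `Q`, and for these `V = (1 + i P) / √2` is a symmetric Clifford unitary.
The operator `slotSum P` is a linear combination of `V^{⊗3}`, `(V†)^{⊗3}` and `P^{⊗3}`: up to
scalars the difference of the first two is the sum of the odd elementary symmetric functions of the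
three commuting copies of `i P` (`tensorPower_three_one_add_sub`). Hence `L` commutes with
`slotSum M` for every `M` in `A` (`commute_slotSum_of_commute`). As `A` is an algebra, this applies
to `U`, `U²` and `U³`, and Newton's identity writes `U ⊗ U ⊗ U` as a polynomial in the power sums
`slotSum U`, `slotSum U²`, `slotSum U³` (`six_smul_tensorPower_three`).

Conversely, suppose that the symmetric Clifford group is a 3-design, and let `g = ∑ c_P P` be the
expansion of an element of `G` in Pauli strings. A Clifford unitary commuting with `g` permutes the
Pauli strings up to signs, and since cubing preserves signs it commutes with
`L = ∑ c_P P ⊗ P ⊗ P` on three copies (`tensorConj_pauliLift`). By the design property `L` commutes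
with all `U ⊗ U ⊗ U`, and differentiating along one-parameter groups it commutes with `slotSum X`
for skew-Hermitian `X` in `A`. Comparing coefficients gives `c_P [X, P] = 0`
(`commute_of_commute_pauliLift`), so every `P` occurring in `g` commutes with the symmetric unitary
group, and the Pauli operators that do so form the required group `Q`.
-/

/-! ### Haar averages and the twirling channel -/

section Twirl

variable {N t : ℕ}

instance (X : Subgroup (QubitUnitary N)) [CompactSpace X] :
    (normalizedHaar X).IsHaarMeasure :=
  Measure.isHaarMeasure_haarMeasure _

instance (X : Subgroup (QubitUnitary N)) [CompactSpace X] :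
    IsProbabilityMeasure (normalizedHaar X) :=
  ⟨Measure.haarMeasure_self (K₀ := (⊤ : PositiveCompacts X))⟩

instance (X : Subgroup (QubitUnitary N)) [CompactSpace X] :
    (normalizedHaar X).IsMulRightInvariant where
  map_mul_right_eq_self g := by
    have : IsProbabilityMeasure ((normalizedHaar X).map (· * g)) :=
      Measure.isProbabilityMeasure_map (measurable_mul_const g).aemeasurable
    exact Measure.isHaarMeasure_eq_of_isProbabilityMeasure _ _

/-- Conjugation of `L` by `U^{⊗t}`. -/
noncomputable def tensorConj (t : ℕ) (U : QubitUnitary N)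
    (L : Matrix (Fin t → Qubits N) (Fin t → Qubits N) ℂ) :
    Matrix (Fin t → Qubits N) (Fin t → Qubits N) ℂ :=
  tensorPower t (U : Matrix (Qubits N) (Qubits N) ℂ) * L *
    (tensorPower t (U : Matrix (Qubits N) (Qubits N) ℂ)).conjTranspose

theorem tensorPower_mul (t : ℕ) (A B : Matrix (Qubits N) (Qubits N) ℂ) :
    tensorPower t (A * B) = tensorPower t A * tensorPower t B :=
  (tensorFamily_mul _ _).symm

theorem tensorPower_conjTranspose (t : ℕ) (A : Matrix (Qubits N) (Qubits N) ℂ) :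
    (tensorPower t A).conjTranspose = tensorPower t A.conjTranspose :=
  tensorFamily_conjTranspose _

theorem tensorPower_conjTranspose_mul_self (t : ℕ) (U : QubitUnitary N) :
    (tensorPower t (U : Matrix (Qubits N) (Qubits N) ℂ)).conjTranspose *
      tensorPower t (U : Matrix (Qubits N) (Qubits N) ℂ) = 1 := by
  rw [tensorPower_conjTranspose, ← tensorPower_mul, ← Matrix.star_eq_conjTranspose,
    Unitary.coe_star_mul_self]
  exact tensorFamily_one

theorem tensorConj_mul (U V : QubitUnitary N)
    (L : Matrix (Fin t → Qubits N) (Fin t → Qubits N) ℂ) :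
    tensorConj t (U * V) L = tensorConj t U (tensorConj t V L) := by
  simp only [tensorConj, Submonoid.coe_mul, tensorPower_mul, Matrix.conjTranspose_mul,
    Matrix.mul_assoc]

theorem tensorConj_eq_self_iff (U : QubitUnitary N)
    (L : Matrix (Fin t → Qubits N) (Fin t → Qubits N) ℂ) :
    tensorConj t U L = L ↔
      Commute L (tensorPower t (U : Matrix (Qubits N) (Qubits N) ℂ)) := by
  have h := tensorPower_conjTranspose_mul_self t U
  have h' := mul_eq_one_comm.mp h
  constructor
  · intro e
    unfold tensorConj at e
    have := congrArg (· * tensorPower t (U : Matrix (Qubits N) (Qubits N) ℂ)) e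
    simp only [Matrix.mul_assoc, h, Matrix.mul_one] at this
    exact this.symm
  · intro e
    rw [tensorConj, ← e.eq, Matrix.mul_assoc, h', Matrix.mul_one]

theorem continuous_tensorConj_apply (L : Matrix (Fin t → Qubits N) (Fin t → Qubits N) ℂ)
    (x y : Fin t → Qubits N) :
    Continuous fun U : QubitUnitary N => tensorConj t U L x y := by
  have hT : Continuous fun U : QubitUnitary N =>
      tensorPower t (U : Matrix (Qubits N) (Qubits N) ℂ) := by
    refine continuous_matrix fun x y => ?_
    simp only [tensorPower, tensorFamily, Matrix.of_apply]
    exact continuous_finsetProd _ fun j _ => continuous_subtype_val.matrix_elem _ _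
  exact ((hT.matrix_mul continuous_const).matrix_mul hT.matrix_conjTranspose).matrix_elem x y

theorem twirl_apply (X : Subgroup (QubitUnitary N)) [CompactSpace X]
    (L : Matrix (Fin t → Qubits N) (Fin t → Qubits N) ℂ) (x y : Fin t → Qubits N) :
    twirl t X L x y = ∫ U : X, tensorConj t (U : QubitUnitary N) L x y ∂normalizedHaar X :=
  rfl

theorem integrable_tensorConj_apply (X : Subgroup (QubitUnitary N)) [CompactSpace X]
    (L : Matrix (Fin t → Qubits N) (Fin t → Qubits N) ℂ) (x y : Fin t → Qubits N) :
    Integrable (fun U : X => tensorConj t (U : QubitUnitary N) L x y) (normalizedHaar X) :=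
  ((continuous_tensorConj_apply L x y).comp continuous_subtype_val).integrable_of_hasCompactSupport
    (HasCompactSupport.of_compactSpace _)

/-- The entrywise integral defining the twirling channel may be tested against every linear
functional. -/
theorem map_twirl (X : Subgroup (QubitUnitary N)) [CompactSpace X]
    (φ : Matrix (Fin t → Qubits N) (Fin t → Qubits N) ℂ →ₗ[ℂ] ℂ)
    (L : Matrix (Fin t → Qubits N) (Fin t → Qubits N) ℂ) :
    φ (twirl t X L) = ∫ U : X, φ (tensorConj t (U : QubitUnitary N) L) ∂normalizedHaar X := by
  have hφ : ∀ M, φ M = ∑ x, ∑ y, M x y * φ (Matrix.single x y 1) := by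
    intro M
    conv_lhs => rw [Matrix.matrix_eq_sum_single M]
    simp only [map_sum]
    refine Finset.sum_congr rfl fun x _ => Finset.sum_congr rfl fun y _ => ?_
    rw [← smul_eq_mul, ← map_smul, Matrix.smul_single, smul_eq_mul, mul_one]
  simp only [hφ (twirl t X L), hφ (tensorConj _ _ _)]
  rw [integral_finsetSum]
  · refine Finset.sum_congr rfl fun x _ => ?_
    rw [integral_finsetSum]
    · refine Finset.sum_congr rfl fun y _ => ?_
      rw [integral_mul_const, twirl_apply]
    · exact fun y _ => (integrable_tensorConj_apply X L x y).mul_const _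
  · exact fun x _ => integrable_finsetSum _ fun y _ =>
      (integrable_tensorConj_apply X L x y).mul_const _

/-- The twirl of `L` lies in the commutant of the group: this is left invariance of the Haar
measure. -/
theorem tensorConj_twirl (X : Subgroup (QubitUnitary N)) [CompactSpace X]
    {V : QubitUnitary N} (hV : V ∈ X)
    (L : Matrix (Fin t → Qubits N) (Fin t → Qubits N) ℂ) :
    tensorConj t V (twirl t X L) = twirl t X L := by
  ext x y
  let φ : Matrix (Fin t → Qubits N) (Fin t → Qubits N) ℂ →ₗ[ℂ] ℂ :=
    { toFun := fun M => tensorConj t V M x y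
      map_add' := fun A B => by
        simp [tensorConj, Matrix.mul_add, Matrix.add_mul]
      map_smul' := fun c A => by simp [tensorConj] }
  change φ (twirl t X L) = _
  rw [map_twirl, twirl_apply,
    ← integral_mul_left_eq_self (fun U : X => tensorConj t (U : QubitUnitary N) L x y) ⟨V, hV⟩]
  simp only [Subgroup.coe_mul, tensorConj_mul]
  rfl

theorem twirl_eq_self (X : Subgroup (QubitUnitary N)) [CompactSpace X]
    {L : Matrix (Fin t → Qubits N) (Fin t → Qubits N) ℂ}
    (h : ∀ U ∈ X, tensorConj t U L = L) : twirl t X L = L := by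
  ext x y
  simp [twirl_apply, h _ (Subtype.coe_prop _)]

/-- Twirling first over a subgroup changes nothing: this is right invariance of the Haar measure. -/
theorem twirl_twirl_of_le {X Y : Subgroup (QubitUnitary N)} [CompactSpace X] [CompactSpace Y]
    (hYX : Y ≤ X) (L : Matrix (Fin t → Qubits N) (Fin t → Qubits N) ℂ) :
    twirl t X (twirl t Y L) = twirl t X L := by
  ext x y
  have hint := fun M => integrable_tensorConj_apply (t := t) X M x y
  let φ : Matrix (Fin t → Qubits N) (Fin t → Qubits N) ℂ →ₗ[ℂ] ℂ :=
    { toFun := fun M => twirl t X M x y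
      map_add' := fun A B => by
        simp only [twirl_apply]
        rw [← integral_add (hint A) (hint B)]
        simp [tensorConj, Matrix.mul_add, Matrix.add_mul]
      map_smul' := fun c A => by
        simp only [twirl_apply, RingHom.id_apply, smul_eq_mul]
        rw [← integral_const_mul]
        simp [tensorConj] }
  change φ (twirl t Y L) = _
  rw [map_twirl]
  have h : ∀ C : Y, φ (tensorConj t (C : QubitUnitary N) L) = twirl t X L x y := by
    intro C
    change twirl t X (tensorConj t (C : QubitUnitary N) L) x y = _
    rw [twirl_apply, twirl_apply,
      ← integral_mul_right_eq_self (fun U : X => tensorConj t (U : QubitUnitary N) L x y)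
        ⟨C, hYX C.2⟩]
    simp only [Subgroup.coe_mul, tensorConj_mul]
  simp [h]

/-- Two nested groups have the same twirling channel as soon as the commutants of their tensor
powers agree. -/
theorem twirl_eq_of_le {X Y : Subgroup (QubitUnitary N)} [CompactSpace X] [CompactSpace Y]
    (hYX : Y ≤ X)
    (h : ∀ L : Matrix (Fin t → Qubits N) (Fin t → Qubits N) ℂ,
      (∀ U ∈ Y, tensorConj t U L = L) → ∀ U ∈ X, tensorConj t U L = L) :
    twirl t Y = twirl t X := by
  funext L
  rw [← twirl_twirl_of_le hYX L]
  exact (twirl_eq_self X (h _ fun U hU => tensorConj_twirl Y hU L)).symm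

end Twirl

/-! ### Operators acting on one tensor factor -/

theorem tensorPower_smul {n : Type*} (t : ℕ) (c : ℂ) (A : Matrix n n ℂ) :
    tensorPower t (c • A) = c ^ t • tensorPower t A := by
  rw [tensorPower, tensorPower, tensorFamily_smul]
  simp

theorem trace_tensorFamily {ι n : Type*} [Fintype ι] [Fintype n] [DecidableEq ι] (A : ι → Matrix n n ℂ) :
    (tensorFamily A).trace = ∏ j, (A j).trace := by
  simp only [Matrix.trace, Matrix.diag, tensorFamily, Matrix.of_apply, Finset.prod_univ_sum,
    Fintype.piFinset_univ]

open NormedSpace in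
theorem commute_of_commute_exp_smul {A : Type*} [NormedRing A] [NormedAlgebra ℝ A]
    [CompleteSpace A] {L Y : A} (h : ∀ s : ℝ, Commute L (exp (s • Y))) : Commute L Y := by
  have hd : HasDerivAt (fun s : ℝ => exp (s • Y)) Y 0 := by
    simpa using hasDerivAt_exp_smul_const (𝕂 := ℝ) Y (0 : ℝ)
  have h1 := hd.const_mul L
  rw [funext fun s => (h s).eq] at h1
  exact h1.unique (hd.mul_const L)

section Slots

variable {n : Type*} [DecidableEq n]

/-- The operator `1 ⊗ ⋯ ⊗ A ⊗ ⋯ ⊗ 1` acting as `A` on the tensor factor `j`. -/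
def slotMatrix {t : ℕ} (j : Fin t) (A : Matrix n n ℂ) :
    Matrix (Fin t → n) (Fin t → n) ℂ :=
  tensorFamily (Function.update 1 j A)

theorem slotMatrix_apply {t : ℕ} (j : Fin t) (A : Matrix n n ℂ) (x y : Fin t → n) :
    slotMatrix j A x y =
      A (x j) (y j) * ∏ i ∈ Finset.univ.erase j, (1 : Matrix n n ℂ) (x i) (y i) := by
  rw [slotMatrix, tensorFamily, Matrix.of_apply,
    ← Finset.mul_prod_erase _ _ (Finset.mem_univ j), Function.update_self]
  congr 1
  refine Finset.prod_congr rfl fun i hi => ?_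
  rw [Function.update_of_ne (Finset.ne_of_mem_erase hi), Pi.one_apply]

variable [Fintype n]

theorem slotMatrix_mul {t : ℕ} (j : Fin t) (A B : Matrix n n ℂ) :
    slotMatrix j (A * B) = slotMatrix j A * slotMatrix j B := by
  rw [slotMatrix, slotMatrix, slotMatrix, tensorFamily_mul]
  congr 1
  funext i
  by_cases h : i = j
  · subst h; simp
  · simp [h]

/-- `A ↦ 1 ⊗ ⋯ ⊗ A ⊗ ⋯ ⊗ 1` as a homomorphism of algebras. -/
def slot {t : ℕ} (j : Fin t) : Matrix n n ℂ →ₐ[ℂ] Matrix (Fin t → n) (Fin t → n) ℂ where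
  toFun := slotMatrix j
  map_one' := by
    rw [slotMatrix, ← Pi.one_apply (M := fun _ => Matrix n n ℂ) j, Function.update_eq_self]
    exact tensorFamily_one
  map_mul' := slotMatrix_mul j
  map_zero' := by ext x y; simp [slotMatrix_apply]
  map_add' A B := by ext x y; simp [slotMatrix_apply, add_mul]
  commutes' c := by
    rw [Algebra.algebraMap_eq_smul_one, Algebra.algebraMap_eq_smul_one]
    have h1 : slotMatrix j (1 : Matrix n n ℂ) = 1 := by
      rw [slotMatrix, ← Pi.one_apply (M := fun _ => Matrix n n ℂ) j, Function.update_eq_self]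
      exact tensorFamily_one
    rw [← h1]
    ext x y
    simp [slotMatrix_apply, mul_assoc]

theorem continuous_slot {t : ℕ} (j : Fin t) : Continuous (slot (n := n) j) := by
  refine continuous_matrix fun x y => ?_
  change Continuous fun A => slotMatrix j A x y
  simp only [slotMatrix_apply]
  exact (continuous_id.matrix_elem _ _).mul continuous_const

theorem commute_slot {t : ℕ} {i j : Fin t} (hij : i ≠ j) (A B : Matrix n n ℂ) :
    Commute (slot i A) (slot j B) := by
  change tensorFamily _ * tensorFamily _ = tensorFamily _ * tensorFamily _
  rw [tensorFamily_mul, tensorFamily_mul]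
  congr 1
  funext k
  by_cases hi : k = i
  · subst hi; simp [hij]
  · simp [hi]

theorem tensorFamily_three (A : Fin 3 → Matrix n n ℂ) :
    tensorFamily A = slot 0 (A 0) * slot 1 (A 1) * slot 2 (A 2) := by
  change _ = tensorFamily _ * tensorFamily _ * tensorFamily _
  rw [tensorFamily_mul, tensorFamily_mul]
  congr 1
  funext k
  fin_cases k <;> simp

theorem tensorPower_three (A : Matrix n n ℂ) :
    tensorPower 3 A = slot 0 A * slot 1 A * slot 2 A :=
  tensorFamily_three _

/-- The action `A ⊗ 1 ⊗ 1 + 1 ⊗ A ⊗ 1 + 1 ⊗ 1 ⊗ A` of the Lie algebra on three copies. -/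
def slotSum : Matrix n n ℂ →ₗ[ℂ] Matrix (Fin 3 → n) (Fin 3 → n) ℂ :=
  (slot 0).toLinearMap + (slot 1).toLinearMap + (slot 2).toLinearMap

theorem slotSum_apply (A : Matrix n n ℂ) : slotSum A = slot 0 A + slot 1 A + slot 2 A := rfl

/-- Newton's identity expressing the third elementary symmetric function `A ⊗ A ⊗ A` of the
commuting operators `A ⊗ 1 ⊗ 1`, `1 ⊗ A ⊗ 1`, `1 ⊗ 1 ⊗ A` by their power sums. -/
theorem six_smul_tensorPower_three (A : Matrix n n ℂ) :
    (6 : ℂ) • tensorPower 3 A = slotSum A * slotSum A * slotSum A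
      - (3 : ℂ) • (slotSum A * slotSum (A * A)) + (2 : ℂ) • slotSum (A * A * A) := by
  have h01 : slot 1 A * slot 0 A = slot 0 A * slot 1 A :=
    (commute_slot (by decide : (1 : Fin 3) ≠ 0) A A).eq
  have h02 : slot 2 A * slot 0 A = slot 0 A * slot 2 A :=
    (commute_slot (by decide : (2 : Fin 3) ≠ 0) A A).eq
  have h12 : slot 2 A * slot 1 A = slot 1 A * slot 2 A :=
    (commute_slot (by decide : (2 : Fin 3) ≠ 1) A A).eq
  have h01' := fun X : Matrix (Fin 3 → n) (Fin 3 → n) ℂ =>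
    (commute_slot (by decide : (1 : Fin 3) ≠ 0) A A).left_comm X
  have h02' := fun X : Matrix (Fin 3 → n) (Fin 3 → n) ℂ =>
    (commute_slot (by decide : (2 : Fin 3) ≠ 0) A A).left_comm X
  have h12' := fun X : Matrix (Fin 3 → n) (Fin 3 → n) ℂ =>
    (commute_slot (by decide : (2 : Fin 3) ≠ 1) A A).left_comm X
  simp only [tensorPower_three, slotSum_apply, map_mul]
  simp only [mul_add, add_mul, mul_assoc, h01, h02, h12, h01', h02', h12']
  module

theorem commute_tensorPower_three_of_slotSum {L : Matrix (Fin 3 → n) (Fin 3 → n) ℂ}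
    {A : Matrix n n ℂ} (h1 : Commute L (slotSum A)) (h2 : Commute L (slotSum (A * A)))
    (h3 : Commute L (slotSum (A * A * A))) : Commute L (tensorPower 3 A) := by
  have h : Commute L ((6 : ℂ) • tensorPower 3 A) := by
    rw [six_smul_tensorPower_three]
    exact ((((h1.mul_right h1).mul_right h1).sub_right ((h1.mul_right h2).smul_right _))).add_right
      (h3.smul_right _)
  simpa [smul_smul] using h.smul_right (6 : ℂ)⁻¹

theorem tensorPower_three_one_add_sub (A : Matrix n n ℂ) :
    tensorPower 3 (1 + A) - tensorPower 3 (1 - A) =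
      (2 : ℂ) • slotSum A + (2 : ℂ) • tensorPower 3 A := by
  simp only [tensorPower_three, slotSum_apply, map_add, map_sub, map_one]
  simp only [mul_add, add_mul, mul_sub, sub_mul, mul_one, one_mul]
  module

open NormedSpace in
/-- An operator commuting with a one-parameter group commutes with its generator. -/
theorem commute_of_exp_smul {L Y : Matrix n n ℂ} (h : ∀ s : ℝ, Commute L (exp (s • Y))) :
    Commute L Y :=
  open scoped Matrix.Norms.Operator in commute_of_commute_exp_smul h

open NormedSpace in
theorem tensorPower_three_exp (A : Matrix n n ℂ) : tensorPower 3 (exp A) = exp (slotSum A) := by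
  have hs : ∀ j : Fin 3, slot j (exp A) = exp (slot j A) := by
    intro j
    open scoped Matrix.Norms.Operator in
    exact map_exp (slot j) (continuous_slot j) A
  have h01 := commute_slot (by decide : (0 : Fin 3) ≠ 1) A A
  have h02 := commute_slot (by decide : (0 : Fin 3) ≠ 2) A A
  have h12 := commute_slot (by decide : (1 : Fin 3) ≠ 2) A A
  rw [slotSum_apply, Matrix.exp_add_of_commute _ _ (h02.add_left h12),
    Matrix.exp_add_of_commute _ _ h01, tensorPower_three, hs, hs, hs]

end Slots

/-! ### Pauli operators -/

section Pauli

variable {N : ℕ}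

theorem pauliMatrix_zero : pauliMatrix 0 = 1 := by
  simp [pauliMatrix, Matrix.one_fin_two]

theorem trace_pauliMatrix {a : Fin 4} (h : a ≠ 0) : (pauliMatrix a).trace = 0 := by
  fin_cases a <;> simp_all [pauliMatrix, Matrix.trace_fin_two]

theorem pauliMatrix_mul_comm (a b : Fin 4) : ∃ e : ℂ, (e = 1 ∨ e = -1) ∧
    pauliMatrix a * pauliMatrix b = e • (pauliMatrix b * pauliMatrix a) := by
  by_cases h : a = b ∨ a = 0 ∨ b = 0
  · refine ⟨1, Or.inl rfl, ?_⟩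
    rcases h with h | h | h <;> simp [h, pauliMatrix_zero]
  · refine ⟨-1, Or.inr rfl, ?_⟩
    fin_cases a <;> fin_cases b <;> simp_all [pauliMatrix]

/-- The single-qubit completeness relation `∑ₐ σₐ ⊗ σₐ = 2 SWAP`. -/
theorem sum_pauliMatrix (i j k l : Fin 2) :
    ∑ a, pauliMatrix a i j * pauliMatrix a k l =
      2 * ((1 : Matrix (Fin 2) (Fin 2) ℂ) i l * (1 : Matrix (Fin 2) (Fin 2) ℂ) j k) := by
  rw [Fin.sum_univ_four]
  fin_cases i <;> fin_cases j <;> fin_cases k <;> fin_cases l <;>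
    simp [pauliMatrix] <;> norm_num

theorem pauliString_zero : pauliString (0 : Fin N → Fin 4) = 1 := by
  simp only [pauliString, Pi.zero_apply, pauliMatrix_zero, tensorFamily_one]

theorem pauliString_mul_self (s : Fin N → Fin 4) : pauliString s * pauliString s = 1 := by
  simp only [pauliString, tensorFamily_mul, pauliMatrix_sq, tensorFamily_one]

theorem trace_pauliString {s : Fin N → Fin 4} (h : s ≠ 0) : (pauliString s).trace = 0 := by
  obtain ⟨j, hj⟩ := Function.ne_iff.mp h
  rw [pauliString, trace_tensorFamily]
  exact Finset.prod_eq_zero (Finset.mem_univ j) (trace_pauliMatrix hj)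

theorem pauliString_mul_comm (s r : Fin N → Fin 4) : ∃ e : ℂ, (e = 1 ∨ e = -1) ∧
    pauliString s * pauliString r = e • (pauliString r * pauliString s) := by
  choose e he h using pauliMatrix_mul_comm
  refine ⟨∏ j, e (s j) (r j), ?_, ?_⟩
  · rw [← sq_eq_one_iff, ← Finset.prod_pow]
    exact Finset.prod_eq_one fun j _ => sq_eq_one_iff.mpr (he _ _)
  · simp only [pauliString, tensorFamily_mul]
    rw [← tensorFamily_smul]
    simp only [← h]

/-- The expansion of an operator in Pauli strings. -/
theorem sum_trace_smul_pauliString (M : Matrix (Qubits N) (Qubits N) ℂ) :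
    ∑ s, (pauliString s * M).trace • pauliString s = (2 : ℂ) ^ N • M := by
  have key : ∀ u v x y : Qubits N, ∑ s, pauliString s u v * pauliString s x y =
      2 ^ N * ((1 : Matrix (Qubits N) (Qubits N) ℂ) u y *
        (1 : Matrix (Qubits N) (Qubits N) ℂ) v x) := by
    intro u v x y
    simp only [pauliString, tensorFamily, Matrix.of_apply, ← Finset.prod_mul_distrib]
    rw [← Fintype.piFinset_univ, ← Finset.prod_univ_sum (fun _ => Finset.univ)
      fun j a => pauliMatrix a (u j) (v j) * pauliMatrix a (x j) (y j)]
    simp only [sum_pauliMatrix, Finset.prod_mul_distrib, Finset.prod_const, Finset.card_univ,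
      Fintype.card_fin]
    rw [← tensorFamily_one (ι := Fin N)]
    rfl
  ext x y
  simp only [Matrix.sum_apply, Matrix.smul_apply, smul_eq_mul, Matrix.trace, Matrix.diag,
    Matrix.mul_apply, Finset.sum_mul]
  rw [Finset.sum_comm]
  calc ∑ u, ∑ s, ∑ v, pauliString s u v * M v u * pauliString s x y
      = ∑ u, ∑ v, M v u * ∑ s, pauliString s u v * pauliString s x y := by
        refine Finset.sum_congr rfl fun u _ => ?_
        rw [Finset.sum_comm]
        refine Finset.sum_congr rfl fun v _ => ?_
        rw [Finset.mul_sum]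
        exact Finset.sum_congr rfl fun s _ => by ring
    _ = 2 ^ N * M x y := by
        simp only [key, Matrix.one_apply]
        simp [mul_comm]

/-- A subspace containing every Pauli string that occurs in the expansion of `M` contains `M`. -/
theorem mem_of_pauliString_mem {M : Matrix (Qubits N) (Qubits N) ℂ}
    (p : Submodule ℂ (Matrix (Qubits N) (Qubits N) ℂ))
    (h : ∀ s, (pauliString s * M).trace ≠ 0 → pauliString s ∈ p) : M ∈ p := by
  have h2 : ((2 : ℂ) ^ N) ≠ 0 := pow_ne_zero _ two_ne_zero
  rw [← p.smul_mem_iff h2, ← sum_trace_smul_pauliString]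
  refine Submodule.sum_mem _ fun s _ => ?_
  by_cases hs : (pauliString s * M).trace = 0
  · simp [hs]
  · exact p.smul_mem _ (h s hs)

/-- A Pauli string as an element of the unitary group. -/
def pauliUnitary (s : Fin N → Fin 4) : QubitUnitary N :=
  ⟨pauliString s, by
    rw [Matrix.mem_unitaryGroup_iff, Matrix.star_eq_conjTranspose, pauliString_conjTranspose,
      pauliString_mul_self]⟩

theorem pauliUnitary_mem (s : Fin N → Fin 4) : pauliUnitary s ∈ pauliGroup N :=
  ⟨1, s, one_pow 4, (one_smul ℂ _).symm⟩

theorem pauliGroup_mul_comm {W R : QubitUnitary N} (hW : W ∈ pauliGroup N)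
    (hR : R ∈ pauliGroup N) : ∃ e : ℂ, (e = 1 ∨ e = -1) ∧
      (W : Matrix (Qubits N) (Qubits N) ℂ) * (R : Matrix (Qubits N) (Qubits N) ℂ) =
        e • ((R : Matrix (Qubits N) (Qubits N) ℂ) * (W : Matrix (Qubits N) (Qubits N) ℂ)) := by
  obtain ⟨c, s, -, hs⟩ := hW
  obtain ⟨d, r, -, hr⟩ := hR
  obtain ⟨e, he, h⟩ := pauliString_mul_comm s r
  refine ⟨e, he, ?_⟩
  rw [hs, hr, Matrix.smul_mul, Matrix.smul_mul, Matrix.mul_smul, Matrix.mul_smul, h]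
  simp only [smul_smul]
  congr 1
  ring

/-- Elements of the Pauli group are pairwise orthogonal or proportional. -/
theorem eq_smul_of_trace_ne_zero {W R : QubitUnitary N} (hW : W ∈ pauliGroup N)
    (hR : R ∈ pauliGroup N)
    (h : ((R : Matrix (Qubits N) (Qubits N) ℂ).conjTranspose *
      (W : Matrix (Qubits N) (Qubits N) ℂ)).trace ≠ 0) :
    ∃ c : ℂ, star c * c = 1 ∧
      (W : Matrix (Qubits N) (Qubits N) ℂ) = c • (R : Matrix (Qubits N) (Qubits N) ℂ) := by
  obtain ⟨c, s, hc, hs⟩ := mul_mem (inv_mem hR) hW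
  have hs' : (R : Matrix (Qubits N) (Qubits N) ℂ).conjTranspose *
      (W : Matrix (Qubits N) (Qubits N) ℂ) = c • pauliString s := hs
  have hs0 : s = 0 := by
    by_contra h0
    rw [hs', Matrix.trace_smul, trace_pauliString h0, smul_zero] at h
    exact h rfl
  refine ⟨c, ?_, ?_⟩
  · have hn : ‖c‖ = 1 := Complex.norm_eq_one_of_pow_eq_one hc (by norm_num)
    rw [Complex.star_def, ← Complex.normSq_eq_conj_mul_self, Complex.normSq_eq_norm_sq, hn]
    simp
  · have hRR : (R : Matrix (Qubits N) (Qubits N) ℂ) *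
        (R : Matrix (Qubits N) (Qubits N) ℂ).conjTranspose = 1 :=
      Matrix.mem_unitaryGroup_iff.mp R.2
    rw [← Matrix.one_mul (W : Matrix (Qubits N) (Qubits N) ℂ), ← hRR, Matrix.mul_assoc, hs', hs0,
      pauliString_zero, Matrix.mul_smul, Matrix.mul_one]

end Pauli

/-! ### Pauli symmetries make the Clifford group a 3-design -/

section PauliSymmetry

variable {N : ℕ}

theorem inv_sqrt_two_mul_self :
    ((Real.sqrt 2 : ℝ) : ℂ)⁻¹ * ((Real.sqrt 2 : ℝ) : ℂ)⁻¹ = 2⁻¹ := by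
  rw [← mul_inv, ← Complex.ofReal_mul, Real.mul_self_sqrt (by norm_num)]
  norm_num

/-- The Clifford unitary `exp (i π P / 4) = (1 + i P) / √2` of a Pauli string `P`. -/
noncomputable def quarterTurn (s : Fin N → Fin 4) : QubitUnitary N :=
  ⟨((Real.sqrt 2 : ℝ) : ℂ)⁻¹ • (1 + Complex.I • pauliString s), by
    rw [Matrix.mem_unitaryGroup_iff, Matrix.star_eq_conjTranspose]
    simp only [Matrix.conjTranspose_smul, Matrix.conjTranspose_add, Matrix.conjTranspose_one,
      pauliString_conjTranspose, star_inv₀, Complex.star_def, Complex.conj_ofReal, Complex.conj_I,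
      Matrix.smul_mul, Matrix.mul_smul, smul_smul, mul_add, add_mul, mul_one, one_mul,
      pauliString_mul_self, neg_mul]
    match_scalars
    · linear_combination 2 * inv_sqrt_two_mul_self - ((Real.sqrt 2 : ℝ) : ℂ)⁻¹ ^ 2 * Complex.I_sq
    · ring⟩

theorem coe_quarterTurn (s : Fin N → Fin 4) :
    (quarterTurn s : Matrix (Qubits N) (Qubits N) ℂ) =
      ((Real.sqrt 2 : ℝ) : ℂ)⁻¹ • (1 + Complex.I • pauliString s) := rfl

theorem coe_quarterTurn_inv (s : Fin N → Fin 4) :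
    ((quarterTurn s)⁻¹ : QubitUnitary N) =
      ((Real.sqrt 2 : ℝ) : ℂ)⁻¹ • (1 - Complex.I • pauliString s) := by
  change star (quarterTurn s : Matrix (Qubits N) (Qubits N) ℂ) = _
  rw [coe_quarterTurn, Matrix.star_eq_conjTranspose]
  simp only [Matrix.conjTranspose_smul, Matrix.conjTranspose_add, Matrix.conjTranspose_one,
    pauliString_conjTranspose, star_inv₀, Complex.star_def, Complex.conj_ofReal, Complex.conj_I,
    neg_smul, sub_eq_add_neg]

/-- The quarter turn about `P` fixes the Pauli operators commuting with `P` and sends the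
operators `W` anticommuting with `P` to `i P W`. -/
theorem quarterTurn_mem_cliffordGroup (s : Fin N → Fin 4) :
    quarterTurn s ∈ cliffordGroup N := by
  have : Finite (pauliGroup N) := (finite_pauliGroup N).to_subtype
  refine Subgroup.mem_normalizer_fintype fun W hW => ?_
  obtain ⟨c, r, hc, hr⟩ := hW
  obtain ⟨e, he, hcomm⟩ := pauliString_mul_comm r s
  have hval : ((quarterTurn s * W * (quarterTurn s)⁻¹ : QubitUnitary N) :
      Matrix (Qubits N) (Qubits N) ℂ) =
        (2⁻¹ * c) • ((1 + e) • pauliString r +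
          (Complex.I * (1 - e)) • (pauliString s * pauliString r)) := by
    have hss : pauliString s * (pauliString s * pauliString r) = pauliString r := by
      rw [← Matrix.mul_assoc, pauliString_mul_self, Matrix.one_mul]
    rw [Submonoid.coe_mul, Submonoid.coe_mul, coe_quarterTurn, coe_quarterTurn_inv, hr]
    simp only [Matrix.smul_mul, Matrix.mul_smul, smul_smul, mul_sub, add_mul, mul_one, one_mul,
      Matrix.mul_assoc, hcomm, hss, smul_sub, smul_add]
    match_scalars
    · linear_combination c * (1 + e) * inv_sqrt_two_mul_self -
        ((Real.sqrt 2 : ℝ) : ℂ)⁻¹ ^ 2 * c * e * Complex.I_sq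
    · linear_combination c * Complex.I * (1 - e) * inv_sqrt_two_mul_self
  rcases he with rfl | rfl
  · refine ⟨c, r, hc, ?_⟩
    rw [hval]
    module
  · obtain ⟨d, q, hd, hq⟩ := pauliString_mul s r
    refine ⟨Complex.I * c * d, q, ?_, ?_⟩
    · rw [mul_pow, mul_pow, hc, hd, Complex.I_pow_four]; norm_num
    · rw [hval, hq]
      module

theorem commute_slotSum_pauliString {Q : Subgroup (QubitUnitary N)}
    {L : Matrix (Fin 3 → Qubits N) (Fin 3 → Qubits N) ℂ}
    (hL : ∀ U ∈ cliffordGroup N, U ∈ symmetricUnitary Q → tensorConj 3 U L = L)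
    {s : Fin N → Fin 4} (hs : ∀ q ∈ Q, Commute (q : Matrix (Qubits N) (Qubits N) ℂ)
      (pauliString s)) :
    Commute L (slotSum (pauliString s)) := by
  have hP : pauliUnitary s ∈ symmetricUnitary Q :=
    Subgroup.mem_centralizer_iff.mpr fun q hq => Subtype.ext (hs q hq).eq
  have hV : quarterTurn s ∈ symmetricUnitary Q :=
    Subgroup.mem_centralizer_iff.mpr fun q hq => Subtype.ext
      (((Commute.one_right _).add_right ((hs q hq).smul_right _)).smul_right _).eq
  have hVC := quarterTurn_mem_cliffordGroup s
  have h1 := (tensorConj_eq_self_iff _ _).mp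
    (hL _ (Subgroup.le_normalizer (pauliUnitary_mem s)) hP)
  have h2 := (tensorConj_eq_self_iff _ _).mp (hL _ hVC hV)
  have h3 := (tensorConj_eq_self_iff _ _).mp (hL _ (inv_mem hVC) (inv_mem hV))
  change Commute L (tensorPower 3 (pauliString s)) at h1
  have h0 : ((((Real.sqrt 2 : ℝ) : ℂ)⁻¹) ^ 3) ≠ 0 := by simp
  rw [coe_quarterTurn, tensorPower_smul] at h2
  rw [coe_quarterTurn_inv, tensorPower_smul] at h3
  have h4 := ((h2.smul_right (((((Real.sqrt 2 : ℝ) : ℂ)⁻¹) ^ 3)⁻¹)).sub_right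
    (h3.smul_right (((((Real.sqrt 2 : ℝ) : ℂ)⁻¹) ^ 3)⁻¹)))
  rw [smul_smul, smul_smul, inv_mul_cancel₀ h0, one_smul, one_smul,
    tensorPower_three_one_add_sub, tensorPower_smul, map_smul] at h4
  have h5 := (h4.sub_right ((h1.smul_right (Complex.I ^ 3)).smul_right (2 : ℂ))).smul_right
    (2 * Complex.I)⁻¹
  rwa [add_sub_cancel_right, smul_smul, smul_smul, mul_assoc, inv_mul_cancel₀ (by simp),
    one_smul] at h5

theorem commute_slotSum_of_commute {Q : Subgroup (QubitUnitary N)} (hQ : Q ≤ pauliGroup N)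
    {L : Matrix (Fin 3 → Qubits N) (Fin 3 → Qubits N) ℂ}
    (hL : ∀ U ∈ cliffordGroup N, U ∈ symmetricUnitary Q → tensorConj 3 U L = L)
    {M : Matrix (Qubits N) (Qubits N) ℂ}
    (hM : ∀ q ∈ Q, Commute (q : Matrix (Qubits N) (Qubits N) ℂ) M) :
    Commute L (slotSum M) := by
  refine (Subalgebra.mem_centralizer_iff ℂ).mp (mem_of_pauliString_mem
    ((Subalgebra.centralizer ℂ {L}).toSubmodule.comap slotSum) fun s hs => ?_) L rfl
  refine (Subalgebra.mem_centralizer_iff ℂ).mpr ?_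
  rintro _ rfl
  refine (commute_slotSum_pauliString hL fun q hq => ?_).eq
  obtain ⟨e, rfl | rfl, he⟩ := pauliGroup_mul_comm (hQ hq) (pauliUnitary_mem s)
  · rw [one_smul] at he
    exact he
  -- If `q` anticommutes with `P` then `tr (P M) = tr (q P M q†) = -tr (P M)`.
  · refine absurd ?_ hs
    have hqq : (q : Matrix (Qubits N) (Qubits N) ℂ).conjTranspose *
        (q : Matrix (Qubits N) (Qubits N) ℂ) = 1 := Matrix.mem_unitaryGroup_iff'.mp q.2
    have he' : (q : Matrix (Qubits N) (Qubits N) ℂ) * pauliString s =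
        (-1 : ℂ) • (pauliString s * (q : Matrix (Qubits N) (Qubits N) ℂ)) := he
    have h : (pauliString s * M).trace = -(pauliString s * M).trace := by
      calc (pauliString s * M).trace
          = (((q : Matrix (Qubits N) (Qubits N) ℂ).conjTranspose *
              (q : Matrix (Qubits N) (Qubits N) ℂ)) * (pauliString s * M)).trace := by
            rw [hqq, Matrix.one_mul]
        _ = ((q : Matrix (Qubits N) (Qubits N) ℂ).conjTranspose *
              (((q : Matrix (Qubits N) (Qubits N) ℂ) * pauliString s) * M)).trace := by
            simp only [Matrix.mul_assoc]
        _ = -((q : Matrix (Qubits N) (Qubits N) ℂ).conjTranspose *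
              (pauliString s * (M * (q : Matrix (Qubits N) (Qubits N) ℂ)))).trace := by
            rw [he', Matrix.smul_mul, Matrix.mul_smul, Matrix.trace_smul, Matrix.mul_assoc,
              (hM q hq).eq]
            simp
        _ = -(pauliString s * M).trace := by
            rw [Matrix.trace_mul_comm, Matrix.mul_assoc, Matrix.mul_assoc,
              mul_eq_one_comm.mp hqq, Matrix.mul_one]
    exact self_eq_neg.mp h

theorem tensorConj_eq_self_of_pauli {Q : Subgroup (QubitUnitary N)} (hQ : Q ≤ pauliGroup N)
    {L : Matrix (Fin 3 → Qubits N) (Fin 3 → Qubits N) ℂ}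
    (hL : ∀ U ∈ cliffordGroup N, U ∈ symmetricUnitary Q → tensorConj 3 U L = L)
    {U : QubitUnitary N} (hU : U ∈ symmetricUnitary Q) : tensorConj 3 U L = L := by
  have hq : ∀ q ∈ Q, Commute (q : Matrix (Qubits N) (Qubits N) ℂ)
      (U : Matrix (Qubits N) (Qubits N) ℂ) :=
    fun q hq => congrArg Subtype.val (Subgroup.mem_centralizer_iff.mp hU q hq)
  refine (tensorConj_eq_self_iff _ _).mpr (commute_tensorPower_three_of_slotSum ?_ ?_ ?_) <;>
    refine commute_slotSum_of_commute hQ hL fun q h => ?_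
  · exact hq q h
  · exact (hq q h).mul_right (hq q h)
  · exact ((hq q h).mul_right (hq q h)).mul_right (hq q h)

end PauliSymmetry

/-! ### Symmetries of a Clifford 3-design are generated by Pauli operators -/

section Converse

variable {N : ℕ}

noncomputable instance : Fintype (pauliGroup N) :=
  have : Finite (pauliGroup N) := (finite_pauliGroup N).to_subtype
  Fintype.ofFinite _

/-- The operator `∑ W, tr (W† g) W ⊗ W ⊗ W†` on three copies, `W` running over the Pauli group.
It is a multiple of `∑ P, c_P P ⊗ P ⊗ P`, with `g = ∑ P, c_P P` the expansion of `g` in Pauli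
strings; each summand is insensitive to the phase of `W`. -/
noncomputable def pauliLift (g : Matrix (Qubits N) (Qubits N) ℂ) :
    Matrix (Fin 3 → Qubits N) (Fin 3 → Qubits N) ℂ :=
  ∑ W : pauliGroup N,
    ((W : Matrix (Qubits N) (Qubits N) ℂ).conjTranspose * g).trace •
      tensorFamily ![(W : Matrix (Qubits N) (Qubits N) ℂ), (W : Matrix (Qubits N) (Qubits N) ℂ),
        (W : Matrix (Qubits N) (Qubits N) ℂ).conjTranspose]

/-- A Clifford unitary commuting with `g` permutes the summands of `pauliLift g`. -/
theorem tensorConj_pauliLift {U : QubitUnitary N} (hU : U ∈ cliffordGroup N)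
    {g : Matrix (Qubits N) (Qubits N) ℂ}
    (hg : Commute g (U : Matrix (Qubits N) (Qubits N) ℂ)) :
    tensorConj 3 U (pauliLift g) = pauliLift g := by
  have hU1 : (U : Matrix (Qubits N) (Qubits N) ℂ) *
      (U : Matrix (Qubits N) (Qubits N) ℂ).conjTranspose = 1 :=
    Matrix.mem_unitaryGroup_iff.mp U.2
  have hU2 := mul_eq_one_comm.mp hU1
  have hsum : tensorConj 3 U (pauliLift g) = ∑ W : pauliGroup N,
      tensorConj 3 U (((W : Matrix (Qubits N) (Qubits N) ℂ).conjTranspose * g).trace •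
        tensorFamily ![(W : Matrix (Qubits N) (Qubits N) ℂ), (W : Matrix (Qubits N) (Qubits N) ℂ),
          (W : Matrix (Qubits N) (Qubits N) ℂ).conjTranspose]) := by
    simp only [tensorConj, pauliLift, Matrix.mul_sum, Matrix.sum_mul]
  rw [hsum]
  refine Fintype.sum_equiv
    (Subgroup.normalizerMonoidHom (pauliGroup N) ⟨U, hU⟩).toEquiv _ _ fun W => ?_
  have hW : (((Subgroup.normalizerMonoidHom (pauliGroup N) ⟨U, hU⟩).toEquiv W : pauliGroup N) :
      Matrix (Qubits N) (Qubits N) ℂ) = (U : Matrix (Qubits N) (Qubits N) ℂ) *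
        (W : Matrix (Qubits N) (Qubits N) ℂ) *
          (U : Matrix (Qubits N) (Qubits N) ℂ).conjTranspose := rfl
  have hconj : ((U : Matrix (Qubits N) (Qubits N) ℂ) * (W : Matrix (Qubits N) (Qubits N) ℂ) *
      (U : Matrix (Qubits N) (Qubits N) ℂ).conjTranspose).conjTranspose =
        (U : Matrix (Qubits N) (Qubits N) ℂ) *
          (W : Matrix (Qubits N) (Qubits N) ℂ).conjTranspose *
            (U : Matrix (Qubits N) (Qubits N) ℂ).conjTranspose := by
    simp [Matrix.mul_assoc]
  have htr : ((U : Matrix (Qubits N) (Qubits N) ℂ) *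
      (W : Matrix (Qubits N) (Qubits N) ℂ).conjTranspose *
        (U : Matrix (Qubits N) (Qubits N) ℂ).conjTranspose * g).trace =
          ((W : Matrix (Qubits N) (Qubits N) ℂ).conjTranspose * g).trace := by
    rw [Matrix.mul_assoc, Matrix.mul_assoc, Matrix.trace_mul_comm, Matrix.mul_assoc,
      Matrix.mul_assoc, hg.eq, ← Matrix.mul_assoc _ _ g, hU2, Matrix.one_mul]
  rw [hW, hconj, htr]
  simp only [tensorConj, Matrix.mul_smul, Matrix.smul_mul, tensorPower,
    tensorFamily_conjTranspose, tensorFamily_mul]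
  congr 2
  funext j
  fin_cases j <;> rfl

theorem trace_tensorFamily_mul_slotSum_commutator
    (B C D X W₀ W₁ W₂ : Matrix (Qubits N) (Qubits N) ℂ) :
    (tensorFamily ![B, C, D] *
      (slotSum X * tensorFamily ![W₀, W₁, W₂] - tensorFamily ![W₀, W₁, W₂] * slotSum X)).trace =
    (B * (X * W₀ - W₀ * X)).trace * (C * W₁).trace * (D * W₂).trace +
    (B * W₀).trace * (C * (X * W₁ - W₁ * X)).trace * (D * W₂).trace +
    (B * W₀).trace * (C * W₁).trace * (D * (X * W₂ - W₂ * X)).trace := by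
  have h0 : slot 0 X = tensorFamily ![X, 1, 1] := by
    rw [tensorFamily_three]; simp
  have h1 : slot 1 X = tensorFamily ![1, X, 1] := by
    rw [tensorFamily_three]; simp
  have h2 : slot 2 X = tensorFamily ![1, 1, X] := by
    rw [tensorFamily_three]; simp
  simp only [slotSum_apply, h0, h1, h2, add_mul, mul_add, mul_sub, Matrix.trace_add,
    Matrix.trace_sub, tensorFamily_mul, trace_tensorFamily, Fin.prod_univ_three]
  simp
  ring

/-- If `X` acting on three copies commutes with `∑ P, c_P P ⊗ P ⊗ P`, then `X` commutes with every
`P` for which `c_P ≠ 0`. -/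
theorem commute_of_commute_pauliLift {g X : Matrix (Qubits N) (Qubits N) ℂ}
    (h : Commute (pauliLift g) (slotSum X)) {R : QubitUnitary N} (hR : R ∈ pauliGroup N)
    (hg : ((R : Matrix (Qubits N) (Qubits N) ℂ).conjTranspose * g).trace ≠ 0) :
    Commute X (R : Matrix (Qubits N) (Qubits N) ℂ) := by
  set r := (R : Matrix (Qubits N) (Qubits N) ℂ) with hr
  have hRR : r * r.conjTranspose = 1 := Matrix.mem_unitaryGroup_iff.mp R.2
  have hRR' : r.conjTranspose * r = 1 := mul_eq_one_comm.mp hRR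
  have hD : ((1 : Matrix (Qubits N) (Qubits N) ℂ)).trace ≠ 0 := by
    rw [Matrix.trace_one]
    exact_mod_cast Fintype.card_ne_zero
  refine sub_eq_zero.mp (Matrix.ext_iff_trace_mul_left.mpr fun B => ?_)
  change (B * (X * r - r * X)).trace = (B * 0).trace
  -- Testing against `B ⊗ R† ⊗ R` isolates the summands of the lift proportional to `R`.
  have hterm : ∀ W : pauliGroup N,
      (tensorFamily ![B, r.conjTranspose, r] * (slotSum X *
        (((W : Matrix (Qubits N) (Qubits N) ℂ).conjTranspose * g).trace •
          tensorFamily ![(W : Matrix (Qubits N) (Qubits N) ℂ),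
            (W : Matrix (Qubits N) (Qubits N) ℂ),
            (W : Matrix (Qubits N) (Qubits N) ℂ).conjTranspose]) -
        (((W : Matrix (Qubits N) (Qubits N) ℂ).conjTranspose * g).trace •
          tensorFamily ![(W : Matrix (Qubits N) (Qubits N) ℂ),
            (W : Matrix (Qubits N) (Qubits N) ℂ),
            (W : Matrix (Qubits N) (Qubits N) ℂ).conjTranspose]) * slotSum X)).trace =
      if (r.conjTranspose * (W : Matrix (Qubits N) (Qubits N) ℂ)).trace ≠ 0 then
        (r.conjTranspose * g).trace * (B * (X * r - r * X)).trace *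
          (1 : Matrix (Qubits N) (Qubits N) ℂ).trace ^ 2 else 0 := by
    intro W
    rw [Matrix.mul_smul, Matrix.smul_mul, ← smul_sub, Matrix.mul_smul, Matrix.trace_smul,
      trace_tensorFamily_mul_slotSum_commutator, smul_eq_mul]
    split_ifs with hW
    · obtain ⟨c, hc, hWc⟩ := eq_smul_of_trace_ne_zero W.2 hR hW
      have e1 : (r.conjTranspose * (X * r - r * X)).trace = 0 := by
        rw [Matrix.mul_sub, Matrix.trace_sub, Matrix.trace_mul_comm, Matrix.mul_assoc, hRR,
          ← Matrix.mul_assoc, hRR', Matrix.mul_one, Matrix.one_mul, sub_self]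
      have e2 : (r * (X * r.conjTranspose - r.conjTranspose * X)).trace = 0 := by
        rw [Matrix.mul_sub, Matrix.trace_sub, Matrix.trace_mul_comm, Matrix.mul_assoc, hRR',
          ← Matrix.mul_assoc, hRR, Matrix.mul_one, Matrix.one_mul, sub_self]
      simp only [hWc, ← hr, Matrix.conjTranspose_smul, Matrix.mul_smul, Matrix.smul_mul,
        ← smul_sub, Matrix.trace_smul, hRR, hRR', e1, e2, smul_eq_mul]
      linear_combination ((r.conjTranspose * g).trace * (B * (X * r - r * X)).trace *
          (1 : Matrix (Qubits N) (Qubits N) ℂ).trace ^ 2) * (star c * c + 1) * hc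
    · have hW0 := not_not.mp hW
      have hW1 : (r * (W : Matrix (Qubits N) (Qubits N) ℂ).conjTranspose).trace = 0 := by
        have := congrArg star hW0
        rw [← Matrix.trace_conjTranspose, Matrix.conjTranspose_mul,
          Matrix.conjTranspose_conjTranspose, Matrix.trace_mul_comm, star_zero] at this
        exact this
      rw [hW0, hW1]
      ring
  have hsum : ∑ W : pauliGroup N,
      (if (r.conjTranspose * (W : Matrix (Qubits N) (Qubits N) ℂ)).trace ≠ 0 then
        (r.conjTranspose * g).trace * (B * (X * r - r * X)).trace *
          (1 : Matrix (Qubits N) (Qubits N) ℂ).trace ^ 2 else 0) = 0 := by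
    simp only [← hterm]
    rw [← Matrix.trace_sum, ← Matrix.mul_sum, Finset.sum_sub_distrib, ← Matrix.mul_sum,
      ← Matrix.sum_mul]
    change (_ * (slotSum X * pauliLift g - pauliLift g * slotSum X)).trace = 0
    rw [h.eq, sub_self, Matrix.mul_zero, Matrix.trace_zero]
  rw [← Finset.sum_filter, Finset.sum_const, smul_eq_zero] at hsum
  have hcard : (Finset.univ.filter fun W : pauliGroup N =>
      (r.conjTranspose * (W : Matrix (Qubits N) (Qubits N) ℂ)).trace ≠ 0).card ≠ 0 := by
    refine Finset.card_ne_zero_of_mem (a := ⟨R, hR⟩) ?_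
    simp only [Finset.mem_filter, Finset.mem_univ, true_and]
    change (r.conjTranspose * r).trace ≠ 0
    rw [hRR']
    exact hD
  have := hsum.resolve_left hcard
  simpa [hg, hD] using this

open NormedSpace in
theorem exp_mem_symmetricUnitary {G : Subgroup (QubitUnitary N)}
    {X : Matrix (Qubits N) (Qubits N) ℂ} (hX : X.conjTranspose = -X)
    (hc : ∀ g ∈ G, Commute (g : Matrix (Qubits N) (Qubits N) ℂ) X) :
    ∃ U ∈ symmetricUnitary G, (U : Matrix (Qubits N) (Qubits N) ℂ) = exp X := by
  have hu : exp X ∈ Matrix.unitaryGroup (Qubits N) ℂ := by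
    rw [Matrix.mem_unitaryGroup_iff, Matrix.star_eq_conjTranspose, ← Matrix.exp_conjTranspose, hX,
      ← Matrix.exp_add_of_commute _ _ (Commute.refl X).neg_right, add_neg_cancel, exp_zero]
  refine ⟨⟨exp X, hu⟩, Subgroup.mem_centralizer_iff.mpr fun g hg => Subtype.ext ?_, rfl⟩
  have : Commute (g : Matrix (Qubits N) (Qubits N) ℂ) (exp X) :=
    open scoped Matrix.Norms.Operator in (hc g hg).exp_right
  exact this.eq

/-- Invariance under the symmetric unitary group, differentiated along the one-parameter group
generated by the skew-Hermitian operator `X`. -/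
theorem commute_slotSum_of_skew {G : Subgroup (QubitUnitary N)}
    {L : Matrix (Fin 3 → Qubits N) (Fin 3 → Qubits N) ℂ}
    (hL : ∀ U ∈ symmetricUnitary G, tensorConj 3 U L = L)
    {X : Matrix (Qubits N) (Qubits N) ℂ} (hX : X.conjTranspose = -X)
    (hc : ∀ g ∈ G, Commute (g : Matrix (Qubits N) (Qubits N) ℂ) X) :
    Commute L (slotSum X) := by
  refine commute_of_exp_smul fun s => ?_
  obtain ⟨U, hU, hUX⟩ := exp_mem_symmetricUnitary (G := G) (X := s • X)
    (by rw [Matrix.conjTranspose_smul, hX, star_trivial, smul_neg])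
    fun g hg => (hc g hg).smul_right s
  have h := (tensorConj_eq_self_iff _ _).mp (hL U hU)
  rwa [hUX, tensorPower_three_exp, LinearMap.map_smul_of_tower] at h

/-- If invariance under the symmetric Clifford group implies invariance under the symmetric unitary
group, the Pauli operators occurring in a symmetry commute with the symmetric unitary group. -/
theorem commute_of_trace_ne_zero {G : Subgroup (QubitUnitary N)}
    (hG : ∀ L : Matrix (Fin 3 → Qubits N) (Fin 3 → Qubits N) ℂ,
      (∀ U ∈ symmetricClifford G, tensorConj 3 U L = L) →
        ∀ U ∈ symmetricUnitary G, tensorConj 3 U L = L)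
    {g R U : QubitUnitary N} (hg : g ∈ G) (hR : R ∈ pauliGroup N)
    (hRg : ((R : Matrix (Qubits N) (Qubits N) ℂ).conjTranspose *
      (g : Matrix (Qubits N) (Qubits N) ℂ)).trace ≠ 0) (hU : U ∈ symmetricUnitary G) :
    Commute (U : Matrix (Qubits N) (Qubits N) ℂ) (R : Matrix (Qubits N) (Qubits N) ℂ) := by
  have hcomm : ∀ V ∈ symmetricUnitary G, ∀ k ∈ G,
      Commute (k : Matrix (Qubits N) (Qubits N) ℂ) (V : Matrix (Qubits N) (Qubits N) ℂ) :=
    fun V hV k hk => congrArg Subtype.val (Subgroup.mem_centralizer_iff.mp hV k hk)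
  have hL := hG (pauliLift (g : Matrix (Qubits N) (Qubits N) ℂ)) fun V hV =>
    tensorConj_pauliLift hV.1 (hcomm V hV.2 g hg)
  set u := (U : Matrix (Qubits N) (Qubits N) ℂ)
  have hu : ∀ k ∈ G, Commute (k : Matrix (Qubits N) (Qubits N) ℂ) u := hcomm U hU
  have hu' : ∀ k ∈ G, Commute (k : Matrix (Qubits N) (Qubits N) ℂ) u.conjTranspose :=
    hcomm U⁻¹ (inv_mem hU)
  have h1 := commute_of_commute_pauliLift (commute_slotSum_of_skew hL (X := u - u.conjTranspose)
    (by simp) fun k hk => (hu k hk).sub_right (hu' k hk)) hR hRg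
  have h2 := commute_of_commute_pauliLift (commute_slotSum_of_skew hL
    (X := Complex.I • (u + u.conjTranspose))
    (by simp [add_comm]) fun k hk => ((hu k hk).add_right (hu' k hk)).smul_right _) hR hRg
  have h3 := (h1.smul_left (2⁻¹ : ℂ)).sub_left (h2.smul_left (2⁻¹ * Complex.I))
  have hs : (2⁻¹ : ℂ) • (u - u.conjTranspose) -
      (2⁻¹ * Complex.I) • Complex.I • (u + u.conjTranspose) = u := by
    rw [smul_smul, mul_assoc, Complex.I_mul_I]
    module
  rwa [hs] at h3

end Converse

/-! ### The characterization -/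

theorem theorem1 (N : ℕ) (G : Subgroup (QubitUnitary N)) :
    IsSymmetricDesign 3 G (symmetricClifford G) ↔
      ∃ Q : Subgroup (QubitUnitary N),
        Q ≤ pauliGroup N ∧ symmetricUnitary G = symmetricUnitary Q := by
  constructor
  · intro h
    have hG : ∀ L : Matrix (Fin 3 → Qubits N) (Fin 3 → Qubits N) ℂ,
        (∀ U ∈ symmetricClifford G, tensorConj 3 U L = L) →
          ∀ U ∈ symmetricUnitary G, tensorConj 3 U L = L := by
      intro L hL U hU
      have hL' : twirl 3 (symmetricUnitary G) L = L := by
        rw [← congrFun h L, twirl_eq_self _ hL]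
      rw [← hL']
      exact tensorConj_twirl _ hU L
    refine ⟨pauliGroup N ⊓ symmetricUnitary (symmetricUnitary G), inf_le_left,
      le_antisymm (fun U hU => ?_) fun V hV => ?_⟩
    · exact Subgroup.mem_centralizer_iff.mpr fun R hR =>
        (Subgroup.mem_centralizer_iff.mp hR.2 U hU).symm
    · refine Subgroup.mem_centralizer_iff.mpr fun g hg => Subtype.ext ?_
      refine ((Subalgebra.mem_centralizer_iff ℂ).mp (mem_of_pauliString_mem
        (Subalgebra.centralizer ℂ {(V : Matrix (Qubits N) (Qubits N) ℂ)}).toSubmodule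
          fun s hs => ?_) _ rfl).symm
      have hsQ : pauliUnitary s ∈ pauliGroup N ⊓ symmetricUnitary (symmetricUnitary G) := by
        refine ⟨pauliUnitary_mem s, Subgroup.mem_centralizer_iff.mpr fun U hU => Subtype.ext ?_⟩
        refine (commute_of_trace_ne_zero hG hg (pauliUnitary_mem s) ?_ hU).eq
        change ((pauliString s).conjTranspose * _).trace ≠ 0
        rwa [pauliString_conjTranspose]
      refine (Subalgebra.mem_centralizer_iff ℂ).mpr ?_
      rintro _ rfl
      exact (congrArg Subtype.val (Subgroup.mem_centralizer_iff.mp hV _ hsQ)).symm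
  · rintro ⟨Q, hQ, hGQ⟩
    refine twirl_eq_of_le inf_le_right fun L hL U hU => ?_
    refine tensorConj_eq_self_of_pauli hQ (fun V hV hVQ => hL V ⟨hV, ?_⟩) (hGQ ▸ hU)
    exact hGQ ▸ hVQ
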